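/- Let $\tfrac34<s<1$, $0<t<1$ and $2_s^*=\frac{6}{3-2s}$. For $\sigma\in(0,1)$ put $C_\sigma=\Big(\int_{\mathbb R^3}\frac{1-\cos\zeta_1}{|\zeta|^{3+2\sigma}}\,d\zeta\Big)^{-1}$ and $$\mathcal E_\sigma(u,v)=\frac{C_\sigma}{2}\iint_{\mathbb R^3\times\mathbb R^3}\frac{(u(x)-u(y))(v(x)-v(y))}{|x-y|^{3+2\sigma}}\,dx\,dy ,$$ which equals $\int_{\mathbb R^3}(-\Delta)^{\sigma/2}u\,(-\Delta)^{\sigma/2}v\,dx$. Let $H^s(\mathbb R^3)=\{u\in L^2(\mathbb R^3):\mathcal E_s(u,u)<\infty\}$ with norm $\|u\|_{H^s}^2=\mathcal E_s(u,u)+\|u\|_{L^2}^2$, and $\mathcal D^{t,2}(\mathbb R^3)=\{\phi\in L^{6/(3-2t)}(\mathbb R^3):\mathcal E_t(\phi,\phi)<\infty\}$ (all functions are real-valued). Let $\alpha_0>0$, and for $n\in\mathbb N$ let $V_n:\mathbb R^3\to\mathbb R$ be measurable with $V_n(x)\ge\alpha_0$ for all $x$. Let $f_n:\mathbb R^3\times\mathbb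 R\to\mathbb R$ be Carathéodory functions such that for every $\delta>0$ there is $C_\delta>0$, independent of $n$, with $$|f_n(x,\tau)|\le\delta|\tau|+C_\delta|\tau|^{2_s^*-1}\qquad\text{for all }n\in\mathbb N,\ (x,\tau)\in\mathbb R^3\times\mathbb R .$$ For each $n$ let $(u_n,\phi_n)$ be a weak solution of $$\begin{cases}(-\Delta)^su+V_n(x)u+\phi u=f_n(x,u)&\text{in }\mathbb R^3,\\(-\Delta)^t\phi=u^2&\text{in }\mathbb R^3,\end{cases}$$ that is, $u_n\in H_n:=\{v\in H^s(\mathbb R^3):\int_{\mathbb R^3}V_nv^2\,dx<\infty\}$, $\phi_n\in\mathcal D^{t,2}(\mathbb R^3)$, $$\mathcal E_s(u_n,v)+\int_{\mathbb R^3}V_nu_nv\,dx+\int_{\mathbb R^3}\phi_nu_nv\,dx=\int_{\mathbb R^3}f_n(x,u_n)v\,dx\quad\text{for all }v\in H_n,$$ $$\mathcal E_t(\phi_n,v)=\int_{\mathbb R^3}u_n^2v\,dx\quad\text{for all }v\in\mathcal D^{t,2}(\mathbb R^3).$$ Assume that $u_n\ge0$ almost everywhere for every $n$, and that $(u_n)$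 converges strongly in $H^s(\mathbb R^3)$ to some $w \in H^s(\mathbb R^3)$. Then there exists $C>0$ such that $$\|u_n\|_{L^\infty(\mathbb R^3)}\le C\qquad\text{for all }n .$$ -/

import Mathlib

open MeasureTheory Filter Topology

namespace FracSP

/-- Euclidean three-space, with the Euclidean norm and Lebesgue measure. -/
abbrev R3 : Type := EuclideanSpace ℝ (Fin 3)

noncomputable section

/-- The critical Sobolev exponent `2_s^* = 6 / (3 - 2s)` in dimension three. -/
def critExp (s : ℝ) : ℝ := 6 / (3 - 2 * s)

/-- The normalization constant `C_s = (∫ (1 - cos ζ₁) / |ζ|^(3+2s) dζ)⁻¹` of the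
fractional Laplacian `(-Δ)^s`. -/
def normConst (s : ℝ) : ℝ :=
  (∫ ζ : R3, (1 - Real.cos (ζ 0)) / ‖ζ‖ ^ (3 + 2 * s))⁻¹

/-- The function `u` has finite Gagliardo seminorm of order `s`, that is,
`∬ |u(x) - u(y)|² / |x - y|^(3+2s) dx dy < ∞`. -/
def FiniteGagliardo (s : ℝ) (u : R3 → ℝ) : Prop :=
  Integrable (fun p : R3 × R3 => (u p.1 - u p.2) ^ 2 / ‖p.1 - p.2‖ ^ (3 + 2 * s))

/-- The bilinear form of `(-Δ)^s`:
`(C_s / 2) ∬ (u(x) - u(y)) (v(x) - v(y)) / |x - y|^(3+2s) dx dy`, which with the above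
constant is `∫ (-Δ)^(s/2) u (-Δ)^(s/2) v dx`. -/
def fracForm (s : ℝ) (u v : R3 → ℝ) : ℝ :=
  normConst s / 2 *
    ∫ p : R3 × R3, (u p.1 - u p.2) * (v p.1 - v p.2) / ‖p.1 - p.2‖ ^ (3 + 2 * s)

/-- The fractional Sobolev space `H^s(ℝ³)`. -/
def MemHs (s : ℝ) (u : R3 → ℝ) : Prop :=
  MemLp u 2 volume ∧ FiniteGagliardo s u

/-- The norm of `H^s(ℝ³)`, `‖u‖² = ∫ |(-Δ)^(s/2) u|² + ∫ |u|²`. -/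
def HsNorm (s : ℝ) (u : R3 → ℝ) : ℝ :=
  Real.sqrt (fracForm s u u + ∫ x, u x ^ 2)

/-- The homogeneous fractional Sobolev space `D^{s,2}(ℝ³)`. -/
def MemD (s : ℝ) (u : R3 → ℝ) : Prop :=
  MemLp u (ENNReal.ofReal (critExp s)) volume ∧ FiniteGagliardo s u

/-- The energy space `{u ∈ H^s(ℝ³) | ∫ V u² < ∞}` of a potential `V` (which is bounded below
by a positive constant wherever this is used). -/
def MemEnergy (s : ℝ) (V : R3 → ℝ) (u : R3 → ℝ) : Prop :=
  MemHs s u ∧ Integrable (fun x => V x * u x ^ 2)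

/-- Carathéodory functions on `ℝ³ × ℝ`: measurable in the space variable, and continuous in
the second variable for almost every point of space. -/
def IsCaratheodory (f : R3 → ℝ → ℝ) : Prop :=
  (∀ τ : ℝ, AEMeasurable (fun x => f x τ) volume) ∧ ∀ᵐ x : R3, Continuous (f x)

/-- The pair `(u, φ)` is a weak solution of the system
`(-Δ)^s u + V(x) u + φ u = f(x, u)`, `(-Δ)^t φ = u²` in `ℝ³`. -/
structure IsWeakSolution (s t : ℝ) (V : R3 → ℝ) (f : R3 → ℝ → ℝ) (u φ : R3 → ℝ) : Prop where
  mem_u : MemEnergy s V u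
  mem_phi : MemD t φ
  eq_u : ∀ v : R3 → ℝ, MemEnergy s V v →
    fracForm s u v + (∫ x, V x * u x * v x) + (∫ x, φ x * u x * v x) = ∫ x, f x (u x) * v x
  eq_phi : ∀ v : R3 → ℝ, MemD t v → fracForm t φ v = ∫ x, u x ^ 2 * v x

end

end FracSP

namespace FracSP

/-! De Giorgi iteration at critical growth. Write `p` for the critical exponent and `Y h` for the
integral of `((u - h)⁺) ^ p`. Test the first equation with `(u - h)⁺`. The term with `φ` is
nonnegative, because `φ ≥ 0` by the weak maximum principle, and the growth bound with `δ = α₀` lets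
the potential absorb the linear part of `f`. What remains is a truncated energy inequality with the
critical power alone on the right (`IsWeakSolution.fracForm_posPart_le`).

The Sobolev inequality turns it into `Y h ≤ (S * C * (h / (h - k)) ^ (p - 1) * Y k) ^ (p / 2)` for
`0 ≤ k < h`. Since `p / 2 > 1`, iterating along levels that increase from `M` to `2 * M` forces `Y
(2 * M) = 0`, provided that `Y M` lies below a threshold depending only on `s` and `C`
(`exists_ae_le_of_integral_posPart_le`).

At critical growth an energy bound alone does not supply this smallness uniformly in `n`; strong
convergence does. Convergence in `H^s` gives convergence in `L^p`, so one level `M₀` chosen for the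
limit serves all large `n`, and the finitely many other indices get levels of their own. -/

/-! ### The critical fractional Sobolev inequality. -/

lemma two_lt_critExp {s : ℝ} (hs : 0 < s) (hs1 : s < 1) : 2 < critExp s := by
  unfold critExp
  rw [lt_div_iff₀ (by linarith)]
  linarith

lemma critExp_identity {s : ℝ} (hs1 : s < 1) :
    critExp s * (2 * s / 3) = critExp s - 2 := by
  unfold critExp
  have : 3 - 2 * s ≠ 0 := by linarith
  field_simp
  ring

lemma one_sub_eq_two_div_critExp {s : ℝ} (hs1 : s < 1) :
    1 - 2 * s / 3 = 2 / critExp s := by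
  unfold critExp
  have : 3 - 2 * s ≠ 0 := by linarith
  field_simp
  norm_num

lemma volume_ball_R3 (x : R3) {m : ℝ} (hm : 0 < m) :
    volume (Metric.ball x ((m / (volume (Metric.ball (0 : R3) 1)).toReal) ^ (1 / 3 : ℝ)))
      = ENNReal.ofReal m := by
  have hc : 0 < (volume (Metric.ball (0 : R3) 1)).toReal :=
    ENNReal.toReal_pos (Metric.measure_ball_pos _ _ one_pos).ne' measure_ball_lt_top.ne
  rw [Measure.addHaar_ball _ _ (by positivity), finrank_euclideanSpace_fin,
    ← Real.rpow_natCast, ← Real.rpow_mul (by positivity),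
    show (1 / 3 : ℝ) * ((3 : ℕ) : ℝ) = 1 by norm_num, Real.rpow_one,
    ENNReal.ofReal_div_of_pos hc, ENNReal.ofReal_toReal measure_ball_lt_top.ne]
  exact ENNReal.div_mul_cancel (Metric.measure_ball_pos _ _ one_pos).ne' measure_ball_lt_top.ne

/-- Pointwise form of the critical fractional Sobolev inequality. -/
lemma exists_rpow_le_mul_lintegral {s : ℝ} (hs : 0 < s) (hs1 : s < 1) :
    ∃ C : ℝ, 0 < C ∧ ∀ u : R3 → ℝ, AEMeasurable u volume → ∀ K : ℝ, 0 < K →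
      (∫⁻ x, ENNReal.ofReal (|u x| ^ critExp s) ≤ ENNReal.ofReal K) → ∀ x,
      ENNReal.ofReal (|u x| ^ critExp s) ≤ ENNReal.ofReal (C * K ^ (2 * s / 3)) *
        ∫⁻ y, ENNReal.ofReal ((u x - u y) ^ 2 / ‖x - y‖ ^ (3 + 2 * s)) := by
  have hp2 := two_lt_critExp hs hs1
  have hpi := critExp_identity hs1
  set p := critExp s with hp
  set c := (volume (Metric.ball (0 : R3) 1)).toReal with hcdef
  have hc : 0 < c :=
    ENNReal.toReal_pos (Metric.measure_ball_pos _ _ one_pos).ne' measure_ball_lt_top.ne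
  refine ⟨8 * c⁻¹ ^ (1 + 2 * s / 3) * (2 ^ (2 * s / 3) * 2 ^ (p - 2)), by positivity, ?_⟩
  intro u hu K hK hle x
  by_cases hx : u x = 0
  · simp [hx, Real.zero_rpow (by linarith : p ≠ 0)]
  set a := |u x| with ha
  have ha0 : 0 < a := abs_pos.2 hx
  -- By Chebyshev, `|u| ≥ a / 2` on a set of measure at most `(2 / a) ^ p * K`. The ball around `x`
  -- is given twice this measure, so on at least half of it `|u y| < a / 2` and hence `|u x - u y| ≥
  -- a / 2`.
  set m := 2 * (2 / a) ^ p * K with hm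
  have hm0 : 0 < m := by positivity
  set r := (m / c) ^ (1 / 3 : ℝ) with hr
  have hr0 : 0 < r := by positivity
  have hball : volume (Metric.ball x r) = ENNReal.ofReal m := volume_ball_R3 x hm0
  set E := {y | ENNReal.ofReal ((a / 2) ^ p) ≤ ENNReal.ofReal (|u y| ^ p)} with hE
  have hEm : volume E ≤ ENNReal.ofReal (m / 2) := by
    have h1 : ENNReal.ofReal ((a / 2) ^ p) * volume E ≤ ENNReal.ofReal K :=
      (mul_meas_ge_le_lintegral₀ (by fun_prop) _).trans hle
    have h2 : m / 2 = K / (a / 2) ^ p := by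
      have : (2 / a) ^ p = ((a / 2) ^ p)⁻¹ := by
        rw [← Real.inv_rpow (by positivity), inv_div]
      rw [hm, this]; field_simp
    rw [h2, ENNReal.ofReal_div_of_pos (by positivity), ENNReal.le_div_iff_mul_le
      (Or.inl (by simp; positivity)) (Or.inl (by simp)), mul_comm]
    exact h1
  have hS : ENNReal.ofReal (m / 2) ≤ volume (Metric.ball x r \ E) := by
    refine le_trans ?_ (le_measure_sdiff)
    rw [hball]
    refine le_trans ?_ (tsub_le_tsub_left hEm _)
    rw [← ENNReal.ofReal_sub _ (by positivity)]
    apply ENNReal.ofReal_le_ofReal; linarith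
  set ε := a ^ 2 / 4 / r ^ (3 + 2 * s) with hε
  have hsub : Metric.ball x r \ E ⊆
      {y | ENNReal.ofReal ε ≤ ENNReal.ofReal ((u x - u y) ^ 2 / ‖x - y‖ ^ (3 + 2 * s))} := by
    rintro y ⟨hy, hyE⟩
    have h1 : |u y| < a / 2 := by
      by_contra! h
      exact hyE (ENNReal.ofReal_le_ofReal (Real.rpow_le_rpow (by positivity) h (by linarith)))
    have hyx : x ≠ y := by
      rintro rfl
      linarith
    have hn : 0 < ‖x - y‖ := norm_pos_iff.2 (sub_ne_zero.2 hyx)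
    have hn2 : ‖x - y‖ ≤ r := by
      rw [Metric.mem_ball, dist_comm, dist_eq_norm] at hy; exact hy.le
    refine ENNReal.ofReal_le_ofReal ?_
    have h3 : a / 2 ≤ |u x - u y| := by
      have := abs_sub_abs_le_abs_sub (u x) (u y)
      linarith
    have h4 : a ^ 2 / 4 ≤ (u x - u y) ^ 2 := by
      rw [← sq_abs (u x - u y)]; nlinarith
    exact div_le_div₀ (sq_nonneg _) h4 (by positivity)
      (Real.rpow_le_rpow hn.le hn2 (by linarith))
  have hmain : ENNReal.ofReal ε * ENNReal.ofReal (m / 2) ≤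
      ∫⁻ y, ENNReal.ofReal ((u x - u y) ^ 2 / ‖x - y‖ ^ (3 + 2 * s)) :=
    (mul_le_mul_right (hS.trans (measure_mono hsub)) _).trans
      (mul_meas_ge_le_lintegral₀ (by fun_prop) _)
  refine le_trans (le_of_eq ?_) (mul_le_mul_right hmain _)
  rw [← ENNReal.ofReal_mul (by positivity), ← ENNReal.ofReal_mul (by positivity)]
  congr 1
  -- The lower bound `ε * (m / 2)` is a constant times `a ^ 2 * m ^ (-(2 * s / 3))`. As `m` is a
  -- multiple of `a ^ (-p) * K` and `p * (2 * s / 3) = p - 2`, the powers of `a` combine to exactly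
  -- `a ^ p`.
  have hrpow : r ^ (3 + 2 * s) = (m * c⁻¹) ^ (1 + 2 * s / 3) := by
    rw [hr, ← Real.rpow_mul (by positivity), div_eq_mul_inv]; congr 1; ring
  have h5 : m ^ (1 + 2 * s / 3) = m * (2 ^ (2 * s / 3) * (2 ^ (p - 2) / a ^ (p - 2)) *
      K ^ (2 * s / 3)) := by
    rw [Real.rpow_add hm0, Real.rpow_one]
    congr 1
    rw [hm, Real.mul_rpow (by positivity) hK.le, Real.mul_rpow (by positivity) (by positivity),
      ← Real.rpow_mul (by positivity), hpi, Real.div_rpow (by positivity) ha0.le]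
  have h6 : a ^ p = a ^ (p - 2) * a ^ 2 := by
    rw [← Real.rpow_natCast, ← Real.rpow_add ha0]; congr 1; norm_num
  rw [hε, hrpow, Real.mul_rpow hm0.le (by positivity), h5, h6]
  have := Real.rpow_pos_of_pos hK (2 * s / 3)
  have := Real.rpow_pos_of_pos ha0 (p - 2)
  have := Real.rpow_pos_of_pos (inv_pos.2 hc) (1 + 2 * s / 3)
  field_simp
  ring

/-- The critical fractional Sobolev inequality on `𝒟^{s,2}(ℝ³)`. -/
lemma exists_sobolev_of_memD {s : ℝ} (hs : 0 < s) (hs1 : s < 1) :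
    ∃ S : ℝ, 0 < S ∧ ∀ u : R3 → ℝ, MemD s u →
      (∫ x, |u x| ^ critExp s) ^ (2 / critExp s) ≤
        S * ∫ q : R3 × R3, (u q.1 - u q.2) ^ 2 / ‖q.1 - q.2‖ ^ (3 + 2 * s) := by
  obtain ⟨C, hC, h⟩ := exists_rpow_le_mul_lintegral hs hs1
  have hp2 := two_lt_critExp hs hs1
  have hpp := one_sub_eq_two_div_critExp hs1
  refine ⟨C, hC, fun u hu => ?_⟩
  set p := critExp s with hp
  obtain ⟨hup, hug⟩ := hu
  have hint : Integrable (fun x => |u x| ^ p) := by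
    have := hup.integrable_norm_rpow (by simp; linarith) (by simp)
    rwa [ENNReal.toReal_ofReal (by linarith)] at this
  set K := ∫ x, |u x| ^ p with hKdef
  have hgn : 0 ≤ ∫ q : R3 × R3, (u q.1 - u q.2) ^ 2 / ‖q.1 - q.2‖ ^ (3 + 2 * s) :=
    integral_nonneg fun q => by positivity
  have hK0 : 0 ≤ K := integral_nonneg fun x => by positivity
  rcases hK0.eq_or_lt with hK | hK
  · rw [← hK, Real.zero_rpow (by positivity)]; positivity
  have hKe : ∫⁻ x, ENNReal.ofReal (|u x| ^ p) = ENNReal.ofReal K :=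
    (ofReal_integral_eq_lintegral_ofReal hint (ae_of_all _ fun x => by positivity)).symm
  have hge : ∫⁻ x, ∫⁻ y, ENNReal.ofReal ((u x - u y) ^ 2 / ‖x - y‖ ^ (3 + 2 * s)) =
      ENNReal.ofReal (∫ q : R3 × R3, (u q.1 - u q.2) ^ 2 / ‖q.1 - q.2‖ ^ (3 + 2 * s)) := by
    rw [ofReal_integral_eq_lintegral_ofReal hug (ae_of_all _ fun x => by positivity)]
    exact (lintegral_prod (fun q : R3 × R3 =>
      ENNReal.ofReal ((u q.1 - u q.2) ^ 2 / ‖q.1 - q.2‖ ^ (3 + 2 * s)))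
      hug.1.aemeasurable.ennreal_ofReal).symm
  have hle : ENNReal.ofReal K ≤ ENNReal.ofReal (C * K ^ (2 * s / 3)) *
      ENNReal.ofReal (∫ q : R3 × R3, (u q.1 - u q.2) ^ 2 / ‖q.1 - q.2‖ ^ (3 + 2 * s)) := by
    rw [← hge, ← lintegral_const_mul' _ _ (by simp), ← hKe]
    exact lintegral_mono fun x => h u hup.1.aemeasurable K hK hKe.le x
  -- Integrating the pointwise bound gives `K ≤ C * K ^ (2 * s / 3) * g`, with `g` the Gagliardo
  -- integral. Dividing by the power of `K` is legitimate because `0 < K < ∞`, the finiteness being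
  -- part of `MemD`.
  rw [← ENNReal.ofReal_mul (by positivity), ENNReal.ofReal_le_ofReal_iff (by positivity)] at hle
  rw [← hpp, Real.rpow_sub hK, Real.rpow_one, div_le_iff₀ (by positivity)]
  linarith


/-! ### The normalization constant, the Gagliardo form and the Sobolev embedding. -/

/-- Without integrability the integral would take the default value `0`, and so would `normConst`.
The integrand has a radial majorant: `1 - cos ζ₁ ≤ ζ₁ ^ 2 / 2` near the origin, where `s < 1` is
needed, and `1 - cos ζ₁ ≤ 2` at infinity, where `s > 0` is needed. -/
lemma normConst_integrable {s : ℝ} (hs : 0 < s) (hs1 : s < 1) :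
    Integrable (fun ζ : R3 => (1 - Real.cos (ζ 0)) / ‖ζ‖ ^ (3 + 2 * s)) := by
  set g : ℝ → ℝ := fun r => if r ≤ 1 then r ^ (-1 - 2 * s) else 2 * r ^ (-3 - 2 * s) with hg
  have hgi : Integrable (fun ζ : R3 => g ‖ζ‖) := by
    rw [integrable_fun_norm_addHaar, finrank_euclideanSpace_fin,
      ← Set.Ioc_union_Ioi_eq_Ioi zero_le_one]
    refine IntegrableOn.union ?_ ?_
    · have h1 : IntegrableOn (fun r : ℝ => r ^ (1 - 2 * s)) (Set.Ioc 0 1) :=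
        (intervalIntegrable_iff_integrableOn_Ioc_of_le zero_le_one).1
          (intervalIntegral.intervalIntegrable_rpow' (by linarith))
      refine h1.congr_fun (fun r hr => ?_) measurableSet_Ioc
      simp only [hg, hr.2, if_true, smul_eq_mul]
      rw [← Real.rpow_natCast, ← Real.rpow_add hr.1]
      congr 1; norm_num; ring
    · have h1 : IntegrableOn (fun r : ℝ => 2 * r ^ (-1 - 2 * s)) (Set.Ioi 1) :=
        (integrableOn_Ioi_rpow_of_lt (by linarith) one_pos).const_mul 2
      refine h1.congr_fun (fun r hr => ?_) measurableSet_Ioi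
      have hr1 : (1 : ℝ) < r := hr
      have hr0 : 0 < r := by linarith
      simp only [hg, not_le.2 hr1, if_false, smul_eq_mul]
      rw [mul_left_comm, ← Real.rpow_natCast, ← Real.rpow_add hr0]
      congr 2; norm_num; ring
  refine hgi.mono' (Measurable.aestronglyMeasurable (by fun_prop)) (ae_of_all _ fun ζ => ?_)
  have hcos := Real.cos_le_one (ζ 0)
  have hcos' := Real.neg_one_le_cos (ζ 0)
  rw [Real.norm_of_nonneg (div_nonneg (by linarith) (by positivity))]
  rcases (norm_nonneg ζ).eq_or_lt with h0 | h0
  · rw [← h0, Real.zero_rpow (by linarith : 3 + 2 * s ≠ 0), div_zero]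
    simp only [hg, zero_le_one, if_true]
    positivity
  rw [div_le_iff₀ (by positivity)]
  simp only [hg]
  split_ifs with h1
  · rw [← Real.rpow_add h0, show -1 - 2 * s + (3 + 2 * s) = ((2 : ℕ) : ℝ) by push_cast; ring,
      Real.rpow_natCast]
    have h2 := Real.one_sub_sq_div_two_le_cos (x := ζ 0)
    have h3 : |ζ 0| ≤ ‖ζ‖ := by simpa using PiLp.norm_apply_le ζ 0
    have h4 : (ζ 0) ^ 2 ≤ ‖ζ‖ ^ 2 := by
      rw [← sq_abs]; exact pow_le_pow_left₀ (abs_nonneg _) h3 2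
    nlinarith [sq_nonneg (ζ 0)]
  · rw [mul_assoc, ← Real.rpow_add h0, show -3 - 2 * s + (3 + 2 * s) = 0 by ring, Real.rpow_zero]
    linarith

lemma normConst_pos {s : ℝ} (hs : 0 < s) (hs1 : s < 1) : 0 < normConst s := by
  refine inv_pos.2 ?_
  rw [integral_pos_iff_support_of_nonneg _ (normConst_integrable hs hs1)]
  · have hU : IsOpen {ζ : R3 | 0 < 1 - Real.cos (ζ 0)} :=
      isOpen_lt continuous_const (by fun_prop)
    refine (hU.measure_pos volume ⟨EuclideanSpace.single 0 Real.pi, ?_⟩).trans_le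
      (measure_mono ?_)
    · simp
    · intro ζ hζ
      have hζ0 : ζ ≠ 0 := by
        rintro rfl
        simp at hζ
      have : 0 < ‖ζ‖ := norm_pos_iff.2 hζ0
      have h1 : 0 < 1 - Real.cos (ζ 0) := hζ
      exact (div_pos h1 (by positivity)).ne'
  · intro ζ
    have hcos := Real.cos_le_one (ζ 0)
    exact div_nonneg (by linarith) (by positivity)

lemma aestronglyMeasurable_gagliardo {s : ℝ} {u v : R3 → ℝ} (hu : AEStronglyMeasurable u volume)
    (hv : AEStronglyMeasurable v volume) :
    AEStronglyMeasurable (fun q : R3 × R3 =>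
      (u q.1 - u q.2) * (v q.1 - v q.2) / ‖q.1 - q.2‖ ^ (3 + 2 * s)) volume := by
  have h : Measurable (fun q : R3 × R3 => (‖q.1 - q.2‖ ^ (3 + 2 * s))⁻¹) := by fun_prop
  simp only [div_eq_mul_inv]
  exact ((hu.comp_fst.sub hu.comp_snd).mul (hv.comp_fst.sub hv.comp_snd)).mul
    h.aestronglyMeasurable

lemma FiniteGagliardo.of_abs_le {s : ℝ} {u v : R3 → ℝ} (hu : FiniteGagliardo s u)
    (hv : AEStronglyMeasurable v volume) (h : ∀ x y, |v x - v y| ≤ |u x - u y|) :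
    FiniteGagliardo s v := by
  refine Integrable.mono' hu (by simpa only [sq] using aestronglyMeasurable_gagliardo hv hv)
    (ae_of_all _ fun q => ?_)
  rw [Real.norm_of_nonneg (by positivity)]
  exact div_le_div_of_nonneg_right (sq_le_sq.2 (h _ _)) (by positivity)

lemma FiniteGagliardo.sub {s : ℝ} {u v : R3 → ℝ} (hu : FiniteGagliardo s u)
    (hv : FiniteGagliardo s v) (hum : AEStronglyMeasurable u volume)
    (hvm : AEStronglyMeasurable v volume) : FiniteGagliardo s (fun x => u x - v x) := by
  refine Integrable.mono' ((hu.const_mul 2).add (hv.const_mul 2))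
    (by simpa only [sq, Pi.sub_apply] using
      aestronglyMeasurable_gagliardo (hum.sub hvm) (hum.sub hvm))
    (ae_of_all _ fun q => ?_)
  rw [Real.norm_of_nonneg (by positivity)]
  simp only [Pi.add_apply, ← mul_div_assoc, ← add_div]
  refine div_le_div_of_nonneg_right ?_ (by positivity)
  nlinarith [sq_nonneg ((u q.1 - u q.2) + (v q.1 - v q.2))]

lemma FiniteGagliardo.neg {s : ℝ} {u : R3 → ℝ} (hu : FiniteGagliardo s u) :
    FiniteGagliardo s (fun x => -u x) := by
  refine hu.congr (ae_of_all _ fun q => ?_)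
  simp only
  congr 1; ring

lemma fracForm_self (s : ℝ) (u : R3 → ℝ) : fracForm s u u = normConst s / 2 *
    ∫ q : R3 × R3, (u q.1 - u q.2) ^ 2 / ‖q.1 - q.2‖ ^ (3 + 2 * s) := by
  simp only [fracForm, sq]

lemma fracForm_neg_left (s : ℝ) (u v : R3 → ℝ) :
    fracForm s (fun x => -u x) v = -fracForm s u v := by
  simp only [fracForm]
  rw [← mul_neg, ← integral_neg]
  congr 2
  ext q
  ring

lemma fracForm_self_nonneg {s : ℝ} (hs : 0 < s) (hs1 : s < 1) (u : R3 → ℝ) :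
    0 ≤ fracForm s u u := by
  rw [fracForm_self]
  exact mul_nonneg (half_pos (normConst_pos hs hs1)).le
    (integral_nonneg fun q => by positivity)

/-- The hypothesis compares the integrands pointwise. It also makes the mixed product nonnegative,
and `a * b ≤ a ^ 2 + b ^ 2` makes it integrable. -/
lemma fracForm_self_le {s : ℝ} (hs : 0 < s) (hs1 : s < 1) {u v : R3 → ℝ}
    (hu : FiniteGagliardo s u) (hv : FiniteGagliardo s v)
    (hum : AEStronglyMeasurable u volume) (hvm : AEStronglyMeasurable v volume)
    (h : ∀ x y, (v x - v y) ^ 2 ≤ (u x - u y) * (v x - v y)) :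
    fracForm s v v ≤ fracForm s u v := by
  rw [fracForm_self, fracForm]
  refine mul_le_mul_of_nonneg_left ?_ (half_pos (normConst_pos hs hs1)).le
  refine integral_mono hv ?_ fun q => div_le_div_of_nonneg_right (h _ _) (by positivity)
  refine Integrable.mono' (hu.add hv) (aestronglyMeasurable_gagliardo hum hvm)
    (ae_of_all _ fun q => ?_)
  have h1 := h q.1 q.2
  rw [Real.norm_of_nonneg (div_nonneg (by nlinarith [sq_nonneg (v q.1 - v q.2)]) (by positivity))]
  simp only [Pi.add_apply, ← add_div]
  refine div_le_div_of_nonneg_right ?_ (by positivity)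
  nlinarith [sq_nonneg ((u q.1 - u q.2) - (v q.1 - v q.2)), sq_nonneg (u q.1 - u q.2),
    sq_nonneg (v q.1 - v q.2)]

lemma exists_sobolev_fracForm {s : ℝ} (hs : 0 < s) (hs1 : s < 1) :
    ∃ S : ℝ, 0 < S ∧ ∀ u : R3 → ℝ, MemD s u →
      (∫ x, |u x| ^ critExp s) ^ (2 / critExp s) ≤ S * fracForm s u u := by
  obtain ⟨S, hS, h⟩ := exists_sobolev_of_memD hs hs1
  have hn := normConst_pos hs hs1
  refine ⟨S * (2 / normConst s), by positivity, fun u hu => (h u hu).trans_eq ?_⟩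
  rw [fracForm_self]
  field_simp

lemma integrable_abs_rpow_iff {p : ℝ} (hp : 0 < p) {u : R3 → ℝ}
    (hu : AEStronglyMeasurable u volume) :
    Integrable (fun x => |u x| ^ p) ↔ MemLp u (ENNReal.ofReal p) volume := by
  rw [← integrable_norm_rpow_iff hu (by simp; linarith) (by simp),
    ENNReal.toReal_ofReal hp.le]
  rfl

lemma abs_clamp_sub_clamp_le (N a b : ℝ) :
    |max (-N) (min a N) - max (-N) (min b N)| ≤ |a - b| := by
  refine (abs_max_sub_max_le_max _ _ _ _).trans ?_
  rw [sub_self, abs_zero]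
  refine max_le (abs_nonneg _) ((abs_min_sub_min_le_max _ _ _ _).trans ?_)
  simp

/-- The fractional Sobolev embedding `H^s(ℝ³) ⊆ 𝒟^{s,2}(ℝ³)`. -/
lemma MemHs.memD {s : ℝ} (hs : 0 < s) (hs1 : s < 1) {u : R3 → ℝ} (hu : MemHs s u) :
    MemD s u := by
  obtain ⟨S, hS, hsob⟩ := exists_sobolev_of_memD hs hs1
  obtain ⟨hu2, hug⟩ := hu
  have hp2 := two_lt_critExp hs hs1
  have hum := hu2.1
  refine ⟨?_, hug⟩
  unfold MemD at hsob
  set p := critExp s with hp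
  -- The Sobolev inequality presupposes that `u` is in `L^p`, so it is applied to truncations. These
  -- are bounded and in `L^2`, hence in `L^p`, and truncating does not increase the Gagliardo
  -- integral. The resulting bound is uniform in `N`, and Fatou's lemma carries it to `u`.
  set T : ℕ → R3 → ℝ := fun N x => max (-(N : ℝ)) (min (u x) N) with hT
  have hTm : ∀ N, AEStronglyMeasurable (T N) volume := fun N =>
    (aemeasurable_const.max (hum.aemeasurable.min aemeasurable_const)).aestronglyMeasurable
  have hTu : ∀ N x, |T N x| ≤ |u x| := fun N x => by
    have := abs_clamp_sub_clamp_le N (u x) 0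
    simpa [hT] using this
  have hTN : ∀ N x, |T N x| ≤ N := fun N x => by
    rw [abs_le]
    exact ⟨le_max_left _ _, max_le (by linarith [N.cast_nonneg (α := ℝ)]) (min_le_right _ _)⟩
  have hTint : ∀ N, Integrable (fun x => |T N x| ^ p) := fun N => by
    refine Integrable.mono' (hu2.integrable_sq.const_mul ((N : ℝ) ^ (p - 2)))
      ((hTm N).aemeasurable.abs.pow_const p).aestronglyMeasurable (ae_of_all _ fun x => ?_)
    rw [Real.norm_of_nonneg (by positivity)]
    rcases (abs_nonneg (T N x)).eq_or_lt with h0 | h0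
    · rw [← h0, Real.zero_rpow (by linarith)]; positivity
    rw [show p = (p - 2) + (2 : ℕ) by norm_num, Real.rpow_add h0, Real.rpow_natCast,
      show p - 2 + (2 : ℕ) - 2 = p - 2 by norm_num, ← sq_abs (u x)]
    exact mul_le_mul (Real.rpow_le_rpow h0.le (hTN N x) (by linarith))
      (pow_le_pow_left₀ h0.le (hTu N x) 2) (by positivity) (by positivity)
  set g := ∫ q : R3 × R3, (u q.1 - u q.2) ^ 2 / ‖q.1 - q.2‖ ^ (3 + 2 * s) with hg
  have hg0 : 0 ≤ g := integral_nonneg fun q => by positivity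
  have hbound : ∀ N, ∫⁻ x, ENNReal.ofReal (|T N x| ^ p) ≤ ENNReal.ofReal ((S * g) ^ (p / 2)) := by
    intro N
    rw [← ofReal_integral_eq_lintegral_ofReal (hTint N) (ae_of_all _ fun x => by positivity)]
    refine ENNReal.ofReal_le_ofReal ?_
    have hTg : FiniteGagliardo s (T N) :=
      hug.of_abs_le (hTm N) fun x y => abs_clamp_sub_clamp_le _ _ _
    have h1 := hsob (T N) ⟨(integrable_abs_rpow_iff (by linarith) (hTm N)).1 (hTint N), hTg⟩
    have h2 : ∫ q : R3 × R3, (T N q.1 - T N q.2) ^ 2 / ‖q.1 - q.2‖ ^ (3 + 2 * s) ≤ g :=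
      integral_mono hTg hug fun q => div_le_div_of_nonneg_right
        (sq_le_sq.2 (abs_clamp_sub_clamp_le _ _ _)) (by positivity)
    have h3 := h1.trans (mul_le_mul_of_nonneg_left h2 hS.le)
    have hK0 : 0 ≤ ∫ x, |T N x| ^ p := integral_nonneg fun x => by positivity
    have h4 := Real.rpow_le_rpow (by positivity) h3 (by linarith : 0 ≤ p / 2)
    rwa [← Real.rpow_mul hK0, show 2 / p * (p / 2) = 1 by field_simp, Real.rpow_one] at h4
  rw [← integrable_abs_rpow_iff (by linarith) hum]
  refine ⟨(hum.aemeasurable.abs.pow_const p).aestronglyMeasurable, ?_⟩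
  rw [hasFiniteIntegral_iff_ofReal (ae_of_all _ fun x => by positivity)]
  have hlim : ∀ x, liminf (fun N => ENNReal.ofReal (|T N x| ^ p)) atTop
      = ENNReal.ofReal (|u x| ^ p) := by
    intro x
    refine (tendsto_const_nhds.congr' ?_).liminf_eq
    filter_upwards [eventually_ge_atTop ⌈|u x|⌉₊] with N hN
    have h1 : |u x| ≤ N := (Nat.le_ceil _).trans (by exact_mod_cast hN)
    rw [abs_le] at h1
    simp only [hT, min_eq_left h1.2, max_eq_right h1.1]
  simp_rw [← hlim]
  refine (lintegral_liminf_le' fun N => ?_).trans_lt ?_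
  · exact ((hTm N).aemeasurable.abs.pow_const p).ennreal_ofReal
  · exact (liminf_le_of_frequently_le' (Frequently.of_forall hbound)).trans_lt
      ENNReal.ofReal_lt_top


/-! ### Truncation at a level, positivity of `φ` and the energy inequality. -/

lemma sq_posPart_sub_le (h a b : ℝ) :
    (max (a - h) 0 - max (b - h) 0) ^ 2 ≤ (a - b) * (max (a - h) 0 - max (b - h) 0) := by
  rcases le_total (a - h) 0 with h1 | h1 <;> rcases le_total (b - h) 0 with h2 | h2 <;>
    simp only [max_eq_left, max_eq_right, h1, h2] <;> nlinarith

lemma abs_posPart_sub_le (h a b : ℝ) :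
    |max (a - h) 0 - max (b - h) 0| ≤ |a - b| := by
  simpa using abs_max_sub_max_le_abs (a - h) (b - h) 0

lemma aestronglyMeasurable_posPart {u : R3 → ℝ} (hu : AEStronglyMeasurable u volume) (h : ℝ) :
    AEStronglyMeasurable (fun x => max (u x - h) 0) volume :=
  ((hu.aemeasurable.sub_const h).max aemeasurable_const).aestronglyMeasurable

lemma posPart_le_abs {h : ℝ} (hh : 0 ≤ h) (a : ℝ) : max (a - h) 0 ≤ |a| :=
  max_le (by linarith [le_abs_self a]) (abs_nonneg a)

lemma ae_eq_zero_of_integral_rpow_eq_zero {p : ℝ} (hp : 0 < p) {v : R3 → ℝ}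
    (hv : Integrable (fun x => |v x| ^ p)) (h : ∫ x, |v x| ^ p = 0) : ∀ᵐ x, v x = 0 := by
  rw [integral_eq_zero_iff_of_nonneg (fun x => by positivity) hv] at h
  filter_upwards [h] with x hx
  simpa using (Real.rpow_eq_zero (abs_nonneg _) hp.ne').1 hx

/-- Weak maximum principle for `(-Δ)^t φ = g` with `g ≥ 0`. -/
lemma ae_nonneg_of_fracForm_eq {t : ℝ} (ht : 0 < t) (ht1 : t < 1) {φ g : R3 → ℝ}
    (hφ : MemD t φ) (hg : ∀ x, 0 ≤ g x)
    (heq : ∀ v : R3 → ℝ, MemD t v → fracForm t φ v = ∫ x, g x * v x) : ∀ᵐ x, 0 ≤ φ x := by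
  obtain ⟨S, hS, hsob⟩ := exists_sobolev_fracForm ht ht1
  have hp2 := two_lt_critExp ht ht1
  set v : R3 → ℝ := fun x => max (-φ x - 0) 0 with hv
  have hvm : AEStronglyMeasurable v volume := aestronglyMeasurable_posPart hφ.1.1.neg 0
  have hvg : FiniteGagliardo t v :=
    hφ.2.neg.of_abs_le hvm fun x y => abs_posPart_sub_le 0 (-φ x) (-φ y)
  have hvp : MemLp v (ENNReal.ofReal (critExp t)) volume := by
    refine hφ.1.of_le hvm (ae_of_all _ fun x => ?_)
    rw [Real.norm_of_nonneg (le_max_right _ _), Real.norm_eq_abs, ← abs_neg (φ x)]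
    exact posPart_le_abs le_rfl _
  have h1 : fracForm t v v ≤ fracForm t (fun x => -φ x) v :=
    fracForm_self_le ht ht1 hφ.2.neg hvg hφ.1.1.neg hvm
      fun x y => sq_posPart_sub_le 0 (-φ x) (-φ y)
  -- With `v` the negative part of `φ`, this gives `fracForm t v v ≤ -∫ g * v ≤ 0`, and the Sobolev
  -- inequality then forces `v = 0`.
  rw [fracForm_neg_left, heq v ⟨hvp, hvg⟩] at h1
  have h2 : 0 ≤ ∫ x, g x * v x :=
    integral_nonneg fun x => mul_nonneg (hg x) (le_max_right _ _)
  have h3 := hsob v ⟨hvp, hvg⟩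
  have hK0 : 0 ≤ ∫ x, |v x| ^ critExp t := integral_nonneg fun x => by positivity
  have h4 : (∫ x, |v x| ^ critExp t) ^ (2 / critExp t) = 0 :=
    le_antisymm (by nlinarith) (by positivity)
  have h5 := (Real.rpow_eq_zero hK0 (by positivity)).1 h4
  filter_upwards [ae_eq_zero_of_integral_rpow_eq_zero (by linarith)
    ((integrable_abs_rpow_iff (by linarith) hvm).2 hvp) h5] with x hx
  have : -φ x - 0 ≤ v x := le_max_left _ _
  linarith

/-- Testing the equation with `(u - h)⁺`. -/
lemma IsWeakSolution.fracForm_posPart_le {s t : ℝ} (hs : 0 < s) (hs1 : s < 1) (ht : 0 < t)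
    (ht1 : t < 1) {α₀ : ℝ} (hα₀ : 0 < α₀) {V : R3 → ℝ} (hVm : AEMeasurable V volume)
    (hV : ∀ x, α₀ ≤ V x) {f : R3 → ℝ → ℝ} {C : ℝ}
    (hf : ∀ x τ, |f x τ| ≤ α₀ * |τ| + C * |τ| ^ (critExp s - 1)) {u φ : R3 → ℝ}
    (hsol : IsWeakSolution s t V f u φ) (hu : ∀ᵐ x, 0 ≤ u x) {h : ℝ} (hh : 0 ≤ h) :
    fracForm s (fun x => max (u x - h) 0) (fun x => max (u x - h) 0) ≤
      C * ∫ x, |u x| ^ (critExp s - 1) * max (u x - h) 0 := by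
  have hp2 := two_lt_critExp hs hs1
  obtain ⟨⟨⟨hu2, hug⟩, huV⟩, hφ, hequ, heqφ⟩ := hsol
  have hup : Integrable (fun x => |u x| ^ critExp s) :=
    (integrable_abs_rpow_iff (by linarith) hu2.1).2 (MemHs.memD hs hs1 ⟨hu2, hug⟩).1
  set p := critExp s with hp
  set v : R3 → ℝ := fun x => max (u x - h) 0 with hv
  have hum := hu2.1
  have hvm : AEStronglyMeasurable v volume := aestronglyMeasurable_posPart hum h
  have hv0 : ∀ x, 0 ≤ v x := fun x => le_max_right _ _
  have hvu : ∀ x, v x ≤ |u x| := fun x => posPart_le_abs hh _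
  have hV0 : ∀ x, 0 ≤ V x := fun x => hα₀.le.trans (hV x)
  have hvg : FiniteGagliardo s v :=
    hug.of_abs_le hvm fun x y => abs_posPart_sub_le h (u x) (u y)
  have hv2 : MemLp v 2 volume := by
    refine hu2.of_le hvm (ae_of_all _ fun x => ?_)
    rw [Real.norm_of_nonneg (hv0 x)]
    exact hvu x
  have hvV : Integrable (fun x => V x * v x ^ 2) := by
    refine huV.mono' (hVm.aestronglyMeasurable.mul (hvm.pow 2)) (ae_of_all _ fun x => ?_)
    rw [Real.norm_of_nonneg (mul_nonneg (hV0 x) (sq_nonneg _)), ← sq_abs (u x)]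
    exact mul_le_mul_of_nonneg_left (pow_le_pow_left₀ (hv0 x) (hvu x) 2) (hV0 x)
  have heq := hequ v ⟨⟨hv2, hvg⟩, hvV⟩
  have hform : fracForm s v v ≤ fracForm s u v :=
    fracForm_self_le hs hs1 hug hvg hum hvm fun x y => sq_posPart_sub_le h (u x) (u y)
  have hφ0 : 0 ≤ ∫ x, φ x * u x * v x := by
    refine integral_nonneg_of_ae ?_
    filter_upwards [hu, ae_nonneg_of_fracForm_eq ht ht1 hφ (fun x => sq_nonneg (u x)) heqφ]
      with x h1 h2
    exact mul_nonneg (mul_nonneg h2 h1) (hv0 x)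
  have huvi : Integrable (fun x => |u x| * v x) := by
    refine hu2.integrable_sq.mono' (hum.norm.mul hvm) (ae_of_all _ fun x => ?_)
    rw [Real.norm_of_nonneg (mul_nonneg (abs_nonneg _) (hv0 x)), ← sq_abs, sq]
    exact mul_le_mul_of_nonneg_left (hvu x) (abs_nonneg _)
  have hVuvi : Integrable (fun x => V x * u x * v x) := by
    refine huV.mono' ((hVm.aestronglyMeasurable.mul hum).mul hvm) (ae_of_all _ fun x => ?_)
    rw [norm_mul, norm_mul, Real.norm_of_nonneg (hv0 x), Real.norm_of_nonneg (hV0 x),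
      ← sq_abs, sq, mul_assoc]
    exact mul_le_mul_of_nonneg_left (mul_le_mul_of_nonneg_left (hvu x) (abs_nonneg _)) (hV0 x)
  have hpvi : Integrable (fun x => |u x| ^ (p - 1) * v x) := by
    refine hup.mono' ((hum.aemeasurable.abs.pow_const _).aestronglyMeasurable.mul hvm)
      (ae_of_all _ fun x => ?_)
    rw [Real.norm_of_nonneg (mul_nonneg (by positivity) (hv0 x))]
    refine (mul_le_mul_of_nonneg_left (hvu x) (by positivity)).trans_eq ?_
    rw [← Real.rpow_add_one' (abs_nonneg _) (by linarith), sub_add_cancel]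
  have hfle : ∫ x, f x (u x) * v x ≤
      α₀ * (∫ x, |u x| * v x) + C * ∫ x, |u x| ^ (p - 1) * v x := by
    rw [← integral_const_mul, ← integral_const_mul,
      ← integral_add (huvi.const_mul _) (hpvi.const_mul _)]
    refine (le_abs_self _).trans ?_
    rw [← Real.norm_eq_abs]
    refine norm_integral_le_of_norm_le ((huvi.const_mul α₀).add (hpvi.const_mul C))
      (ae_of_all _ fun x => ?_)
    rw [norm_mul, Real.norm_of_nonneg (hv0 x)]
    refine (mul_le_mul_of_nonneg_right (hf x (u x)) (hv0 x)).trans_eq ?_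
    ring
  -- The linear part of the bound on `f` carries the coefficient `α₀`, so it cancels against the
  -- potential term.
  have hVle : α₀ * (∫ x, |u x| * v x) ≤ ∫ x, V x * u x * v x := by
    rw [← integral_const_mul]
    refine integral_mono_ae (huvi.const_mul _) hVuvi ?_
    filter_upwards [hu] with x hx
    rw [abs_of_nonneg hx, mul_assoc]
    exact mul_le_mul_of_nonneg_right (hV x) (mul_nonneg hx (hv0 x))
  linarith

/-! ### The De Giorgi iteration. -/

/-- Only `a > h` matters. There `a / (a - k)` is decreasing in `a`, hence at most `h / (h - k)`, so
the full power of `a` is controlled by the truncation at the lower level `k`. -/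
lemma rpow_mul_posPart_le {p k h a : ℝ} (hp : 1 < p) (hk : 0 ≤ k) (hkh : k < h) (ha : 0 ≤ a) :
    |a| ^ (p - 1) * max (a - h) 0 ≤ (h / (h - k)) ^ (p - 1) * max (a - k) 0 ^ p := by
  have hhk : 0 < h - k := sub_pos.2 hkh
  have hh : 0 < h := by linarith
  rcases le_total a h with h1 | h1
  · rw [max_eq_right (by linarith : a - h ≤ 0), mul_zero]
    positivity
  have hak : 0 < a - k := by linarith
  rw [abs_of_nonneg ha, max_eq_left (by linarith : 0 ≤ a - h), max_eq_left hak.le]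
  have h2 : a ≤ h / (h - k) * (a - k) := by
    rw [div_mul_eq_mul_div, le_div_iff₀ hhk]
    nlinarith
  have h3 : a ^ (p - 1) ≤ (h / (h - k)) ^ (p - 1) * (a - k) ^ (p - 1) := by
    rw [← Real.mul_rpow (by positivity) hak.le]
    exact Real.rpow_le_rpow ha h2 (by linarith)
  calc a ^ (p - 1) * (a - h) ≤ ((h / (h - k)) ^ (p - 1) * (a - k) ^ (p - 1)) * (a - k) :=
        mul_le_mul h3 (by linarith) (by linarith) (by positivity)
    _ = _ := by
        rw [mul_assoc, ← Real.rpow_add_one hak.ne', sub_add_cancel]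

/-- Fast geometric convergence of a nonlinear recursion with small initial datum. -/
lemma exists_tendsto_zero_of_superlinear {A B q : ℝ} (hA : 0 < A) (hB : 1 < B) (hq : 1 < q) :
    ∃ ε : ℝ, 0 < ε ∧ ∀ y : ℕ → ℝ, (∀ j, 0 ≤ y j) → (∀ j, y (j + 1) ≤ (A * B ^ j * y j) ^ q) →
      y 0 ≤ ε → Tendsto y atTop (𝓝 0) := by
  -- The ratio `l` solves `(B * l) ^ q = l`, and `ε` solves `A ^ q * ε ^ (q - 1) = l`. With these
  -- choices the bound `y j ≤ ε * l ^ j` reproduces itself under the recursion.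
  have hB0 : 0 < B := by linarith
  have hq1 : q - 1 ≠ 0 := by linarith
  set l : ℝ := B ^ (-(q / (q - 1))) with hl
  have hl0 : 0 < l := by positivity
  have hl1 : l < 1 := Real.rpow_lt_one_of_one_lt_of_neg hB
    (neg_lt_zero.2 (div_pos (by linarith) (by linarith)))
  have hBl : (B * l) ^ q = l := by
    rw [hl, ← Real.rpow_one_add' hB0.le, ← Real.rpow_mul hB0.le]
    · congr 1; field_simp; ring
    · have : 1 + -(q / (q - 1)) = -(1 / (q - 1)) := by field_simp; ring
      rw [this]
      exact neg_ne_zero.2 (one_div_ne_zero hq1)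
  set ε : ℝ := (l / A ^ q) ^ (1 / (q - 1)) with hε
  have hε0 : 0 < ε := by positivity
  have hεq : A ^ q * ε ^ (q - 1) = l := by
    rw [hε, ← Real.rpow_mul (by positivity), one_div_mul_cancel hq1, Real.rpow_one]
    field_simp
  refine ⟨ε, hε0, fun y hy hrec h0 => ?_⟩
  have key : ∀ j, y j ≤ ε * l ^ j := by
    intro j
    induction j with
    | zero => simpa using h0
    | succ j ih =>
      have h1 : A * B ^ j * y j ≤ A * ε * (B * l) ^ j := by
        rw [mul_pow]
        calc A * B ^ j * y j ≤ A * B ^ j * (ε * l ^ j) :=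
              mul_le_mul_of_nonneg_left ih (by positivity)
          _ = _ := by ring
      have h2 := Real.rpow_le_rpow (by have := hy j; positivity) h1 (by linarith : 0 ≤ q)
      refine (hrec j).trans (h2.trans_eq ?_)
      rw [Real.mul_rpow (by positivity) (by positivity), Real.mul_rpow hA.le hε0.le,
        ← Real.rpow_pow_comm (by positivity), hBl, pow_succ]
      have : ε ^ q = ε * ε ^ (q - 1) := by
        rw [Real.rpow_sub_one hε0.ne']; field_simp
      rw [this]
      linear_combination ε * l ^ j * hεq
  refine squeeze_zero hy key ?_
  simpa using (tendsto_pow_atTop_nhds_zero_of_lt_one hl0.le hl1).const_mul ε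

lemma integrable_posPart_rpow {p : ℝ} (hp : 0 < p) {u : R3 → ℝ}
    (hum : AEStronglyMeasurable u volume) (hup : Integrable (fun x => |u x| ^ p)) {h : ℝ}
    (hh : 0 ≤ h) : Integrable (fun x => max (u x - h) 0 ^ p) := by
  refine hup.mono' ((aestronglyMeasurable_posPart hum h).aemeasurable.pow_const
    p).aestronglyMeasurable (ae_of_all _ fun x => ?_)
  have h0 : 0 ≤ max (u x - h) 0 := le_max_right _ _
  rw [Real.norm_of_nonneg (by positivity)]
  exact Real.rpow_le_rpow h0 (posPart_le_abs hh _) hp.le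

/-- De Giorgi's boundedness theorem: a function satisfying the truncated energy inequality with
critical growth is bounded by `2M` if `(u - M)⁺` is small in the critical Lebesgue space. -/
lemma exists_ae_le_of_integral_posPart_le {s : ℝ} (hs : 0 < s) (hs1 : s < 1) {C : ℝ}
    (hC : 0 < C) :
    ∃ ε : ℝ, 0 < ε ∧ ∀ u : R3 → ℝ, MemHs s u → (∀ᵐ x, 0 ≤ u x) →
      (∀ h : ℝ, 0 ≤ h → fracForm s (fun x => max (u x - h) 0) (fun x => max (u x - h) 0) ≤
        C * ∫ x, |u x| ^ (critExp s - 1) * max (u x - h) 0) →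
      ∀ M : ℝ, 0 < M → ∫ x, max (u x - M) 0 ^ critExp s ≤ ε → ∀ᵐ x, u x ≤ 2 * M := by
  obtain ⟨S, hS, hsob⟩ := exists_sobolev_fracForm hs hs1
  have hp2 := two_lt_critExp hs hs1
  set p := critExp s with hp
  -- The constants anticipate the levels `M * (2 - 2 ^ (-j))`, for which `h / (h - k) ≤ 4 * 2 ^ j`
  -- between consecutive levels, raised to the power `p - 1`. The threshold therefore does not
  -- depend on `u` or `M`.
  obtain ⟨ε, hε, hlim⟩ := exists_tendsto_zero_of_superlinear
    (A := S * C * 4 ^ (p - 1)) (B := 2 ^ (p - 1)) (q := p / 2) (by positivity)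
    (Real.one_lt_rpow one_lt_two (by linarith)) (by linarith)
  refine ⟨ε, hε, fun u hu hu0 hen M hM hsmall => ?_⟩
  have hum := hu.1.1
  have hup : Integrable (fun x => |u x| ^ p) :=
    (integrable_abs_rpow_iff (by linarith) hum).2 (hu.memD hs hs1).1
  set Y : ℝ → ℝ := fun h => ∫ x, max (u x - h) 0 ^ p with hY
  have hY0 : ∀ h, 0 ≤ Y h := fun h => integral_nonneg fun x => by positivity
  have hrec : ∀ k h : ℝ, 0 ≤ k → k < h →
      Y h ≤ (S * C * (h / (h - k)) ^ (p - 1) * Y k) ^ (p / 2) := by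
    intro k h hk hkh
    have hh : 0 ≤ h := by linarith
    have hvD : MemD s (fun x => max (u x - h) 0) := by
      have hm := aestronglyMeasurable_posPart hum h
      refine ⟨(integrable_abs_rpow_iff (by linarith) hm).1 ?_,
        hu.2.of_abs_le hm fun x y => abs_posPart_sub_le h (u x) (u y)⟩
      simpa only [abs_of_nonneg (le_max_right _ (0 : ℝ))] using
        integrable_posPart_rpow (by linarith) hum hup hh
    have h1 := hsob _ hvD
    simp only [abs_of_nonneg (le_max_right _ (0 : ℝ))] at h1
    have h2 : ∫ x, |u x| ^ (p - 1) * max (u x - h) 0 ≤ (h / (h - k)) ^ (p - 1) * Y k := by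
      rw [hY, ← integral_const_mul]
      refine integral_mono_of_nonneg (ae_of_all _ fun x => ?_)
        ((integrable_posPart_rpow (by linarith) hum hup hk).const_mul _) ?_
      · exact mul_nonneg (by positivity) (le_max_right _ _)
      · filter_upwards [hu0] with x hx
        exact rpow_mul_posPart_le (by linarith) hk hkh hx
    have h3 : Y h ^ (2 / p) ≤ S * C * (h / (h - k)) ^ (p - 1) * Y k :=
      calc Y h ^ (2 / p) ≤ S * (C * ((h / (h - k)) ^ (p - 1) * Y k)) :=
            h1.trans (mul_le_mul_of_nonneg_left ((hen h hh).trans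
              (mul_le_mul_of_nonneg_left h2 hC.le)) hS.le)
        _ = _ := by ring
    have h4 := Real.rpow_le_rpow (by have := hY0 h; positivity) h3 (by linarith : 0 ≤ p / 2)
    rwa [← Real.rpow_mul (hY0 h), show 2 / p * (p / 2) = 1 by field_simp, Real.rpow_one] at h4
  set κ : ℕ → ℝ := fun j => M * (2 - (1 / 2) ^ j) with hκ
  have hhalf : ∀ j : ℕ, (1 / 2 : ℝ) ^ j ≤ 1 := fun j => pow_le_one₀ (by norm_num) (by norm_num)
  have hκ0 : ∀ j, 0 ≤ κ j := fun j => mul_nonneg hM.le (by linarith [hhalf j])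
  have hκd : ∀ j, κ (j + 1) - κ j = M * (1 / 2) ^ (j + 1) := fun j => by
    simp only [hκ, pow_succ]; ring
  have hstep : ∀ j, Y (κ (j + 1)) ≤
      (S * C * 4 ^ (p - 1) * (2 ^ (p - 1)) ^ j * Y (κ j)) ^ (p / 2) := by
    intro j
    have hd : 0 < κ (j + 1) - κ j := by rw [hκd]; positivity
    refine (hrec _ _ (hκ0 j) (sub_pos.1 hd)).trans ?_
    have hY1 := hY0 (κ j)
    have hκ1 := hκ0 (j + 1)
    refine Real.rpow_le_rpow (by positivity) ?_ (by linarith)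
    refine mul_le_mul_of_nonneg_right ?_ hY1
    rw [mul_assoc (S * C)]
    refine mul_le_mul_of_nonneg_left ?_ (by positivity)
    have h5 : κ (j + 1) / (κ (j + 1) - κ j) ≤ 4 * 2 ^ j := by
      rw [div_le_iff₀ hd, hκd]
      have : (4 * 2 ^ j) * (M * (1 / 2 : ℝ) ^ (j + 1)) = 2 * M := by
        rw [one_div, inv_pow, pow_succ]; field_simp; norm_num
      rw [this]
      have : 0 < (1 / 2 : ℝ) ^ (j + 1) := by positivity
      simp only [hκ]
      nlinarith
    refine (Real.rpow_le_rpow (by positivity) h5 (by linarith)).trans_eq ?_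
    rw [Real.mul_rpow (by norm_num) (by positivity), Real.rpow_pow_comm zero_le_two]
  have htend := hlim (fun j => Y (κ j)) (fun j => hY0 _) hstep (by
    have : κ 0 = M := by simp only [hκ, pow_zero]; ring
    simpa only [this] using hsmall)
  have hint2 := integrable_posPart_rpow (p := p) (by linarith) hum hup (by linarith : 0 ≤ 2 * M)
  -- Every level `κ j` lies below `2 * M`, so `Y (2 * M)` is at most each `Y (κ j)`, and these tend
  -- to `0`.
  have hle : Y (2 * M) ≤ 0 := by
    refine ge_of_tendsto' htend fun j => ?_
    refine integral_mono hint2 (integrable_posPart_rpow (by linarith) hum hup (hκ0 j)) fun x => ?_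
    refine Real.rpow_le_rpow (le_max_right _ _) (max_le_max_right _ ?_) (by linarith)
    have : 0 < (1 / 2 : ℝ) ^ j := by positivity
    simp only [hκ]
    nlinarith
  have habs : (fun x => |max (u x - 2 * M) 0| ^ p) = fun x => max (u x - 2 * M) 0 ^ p := by
    simp only [abs_of_nonneg (le_max_right _ (0 : ℝ))]
  filter_upwards [ae_eq_zero_of_integral_rpow_eq_zero (p := p) (by linarith)
    (v := fun x => max (u x - 2 * M) 0) (habs ▸ hint2)
    (by rw [habs]; exact le_antisymm hle (hY0 _))] with x hx
  have := le_max_left (u x - 2 * M) 0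
  linarith

/-! ### Uniform smallness of the tails along a convergent sequence. -/

lemma tendsto_integral_posPart_rpow {p : ℝ} (hp : 0 < p) {g : R3 → ℝ}
    (hgm : AEStronglyMeasurable g volume) (hg : Integrable (fun x => |g x| ^ p)) :
    Tendsto (fun M : ℝ => ∫ x, max (g x - M) 0 ^ p) atTop (𝓝 0) := by
  have h := tendsto_integral_filter_of_dominated_convergence (μ := volume) (l := atTop)
    (F := fun M : ℝ => fun x => max (g x - M) 0 ^ p) (f := fun _ => 0) (fun x => |g x| ^ p)
    (Eventually.of_forall fun M => ((aestronglyMeasurable_posPart hgm M).aemeasurable.pow_const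
      p).aestronglyMeasurable) ?_ hg ?_
  · simpa using h
  · filter_upwards [eventually_ge_atTop 0] with M hM
    refine ae_of_all _ fun x => ?_
    have h0 : 0 ≤ max (g x - M) 0 := le_max_right _ _
    rw [Real.norm_of_nonneg (by positivity)]
    exact Real.rpow_le_rpow h0 (posPart_le_abs hM _) hp.le
  · refine ae_of_all _ fun x => tendsto_const_nhds.congr' ?_
    filter_upwards [eventually_ge_atTop (g x)] with M hM
    rw [max_eq_right (by linarith), Real.zero_rpow hp.ne']

/-- Transfers smallness of the tail from the limit `b` to a nearby function `a` at the same level,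
since `(a - M)⁺ ≤ |a - b| + (b - M)⁺`. -/
lemma posPart_rpow_le {p : ℝ} (hp : 0 < p) (M a b : ℝ) :
    max (a - M) 0 ^ p ≤ 2 ^ p * (|a - b| ^ p + max (b - M) 0 ^ p) := by
  set c := max (b - M) 0 with hc
  have hc0 : 0 ≤ c := le_max_right _ _
  have hc1 : b - M ≤ c := le_max_left _ _
  have h1 : max (a - M) 0 ≤ 2 * max |a - b| c := by
    have := le_max_left |a - b| c
    have := le_max_right |a - b| c
    refine max_le ?_ (by positivity)
    linarith [le_abs_self (a - b)]
  refine (Real.rpow_le_rpow (le_max_right _ _) h1 hp.le).trans ?_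
  rw [Real.mul_rpow (by norm_num) (by positivity)]
  refine mul_le_mul_of_nonneg_left ?_ (by positivity)
  rcases max_cases |a - b| c with ⟨h, -⟩ | ⟨h, -⟩ <;> rw [h]
  · linarith [Real.rpow_nonneg hc0 p]
  · linarith [Real.rpow_nonneg (abs_nonneg (a - b)) p]

lemma MemHs.sub {s : ℝ} {u v : R3 → ℝ} (hu : MemHs s u) (hv : MemHs s v) :
    MemHs s (fun x => u x - v x) :=
  ⟨hu.1.sub hv.1, hu.2.sub hv.2 hu.1.1 hv.1.1⟩

lemma integrable_rpow_critExp {s : ℝ} (hs : 0 < s) (hs1 : s < 1) {u : R3 → ℝ} (hu : MemHs s u) :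
    Integrable (fun x => |u x| ^ critExp s) :=
  (integrable_abs_rpow_iff (by linarith [two_lt_critExp hs hs1]) hu.1.1).2 (hu.memD hs hs1).1

/-- Convergence in `H^s` implies convergence in the critical Lebesgue space. -/
lemma tendsto_integral_rpow_of_tendsto_HsNorm {s : ℝ} (hs : 0 < s) (hs1 : s < 1)
    {v : ℕ → R3 → ℝ} (hv : ∀ n, MemHs s (v n))
    (h : Tendsto (fun n => HsNorm s (v n)) atTop (𝓝 0)) :
    Tendsto (fun n => ∫ x, |v n x| ^ critExp s) atTop (𝓝 0) := by
  obtain ⟨S, hS, hsob⟩ := exists_sobolev_fracForm hs hs1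
  have hp2 := two_lt_critExp hs hs1
  set p := critExp s with hp
  have hbound : ∀ n, ∫ x, |v n x| ^ p ≤ (S * HsNorm s (v n) ^ 2) ^ (p / 2) := by
    intro n
    have hF := fracForm_self_nonneg hs hs1 (v n)
    have hL : 0 ≤ ∫ x, v n x ^ 2 := integral_nonneg fun x => sq_nonneg _
    have h1 : fracForm s (v n) (v n) ≤ HsNorm s (v n) ^ 2 := by
      rw [HsNorm, Real.sq_sqrt (by linarith)]; linarith
    have h2 := (hsob _ ((hv n).memD hs hs1)).trans (mul_le_mul_of_nonneg_left h1 hS.le)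
    have hK : 0 ≤ ∫ x, |v n x| ^ p := integral_nonneg fun x => by positivity
    have h4 := Real.rpow_le_rpow (by positivity) h2 (by linarith : 0 ≤ p / 2)
    rwa [← Real.rpow_mul hK, show 2 / p * (p / 2) = 1 by field_simp, Real.rpow_one] at h4
  refine squeeze_zero (fun n => integral_nonneg fun x => by positivity) hbound ?_
  have h5 := ((h.pow 2).const_mul S).rpow_const (p := p / 2) (Or.inr (by linarith))
  simpa [Real.zero_rpow (by linarith : p / 2 ≠ 0)] using h5

end FracSP

theorem proposition5p1 (s t : ℝ) (hs : 3 / 4 < s) (hs1 : s < 1) (ht : 0 < t) (ht1 : t < 1)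
    (α₀ : ℝ) (hα₀ : 0 < α₀)
    (V : ℕ → FracSP.R3 → ℝ) (hVmeas : ∀ n, AEMeasurable (V n) volume)
    (hV : ∀ n x, α₀ ≤ V n x)
    (f : ℕ → FracSP.R3 → ℝ → ℝ) (hfcar : ∀ n, FracSP.IsCaratheodory (f n))
    (hf : ∀ δ : ℝ, 0 < δ → ∃ Cδ : ℝ, 0 < Cδ ∧ ∀ n x τ,
      |f n x τ| ≤ δ * |τ| + Cδ * |τ| ^ (FracSP.critExp s - 1))
    (u φ : ℕ → FracSP.R3 → ℝ)
    (hsol : ∀ n, FracSP.IsWeakSolution s t (V n) (f n) (u n) (φ n))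
    (hpos : ∀ n, ∀ᵐ x : FracSP.R3, 0 ≤ u n x)
    (w : FracSP.R3 → ℝ) (hw : FracSP.MemHs s w)
    (hconv : Tendsto (fun n => FracSP.HsNorm s (fun x => u n x - w x)) atTop (𝓝 0)) :
    ∃ C : ℝ, 0 < C ∧ ∀ n, eLpNorm (u n) ⊤ volume ≤ ENNReal.ofReal C := by
  have hs0 : 0 < s := by linarith
  have hp2 := FracSP.two_lt_critExp hs0 hs1
  have huH : ∀ n, FracSP.MemHs s (u n) := fun n => (hsol n).mem_u.1
  -- Taking `δ = α₀` fixes one constant `C` for all `n`, so the De Giorgi threshold `ε` is common to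
  -- the whole sequence.
  obtain ⟨C, hC, hfC⟩ := hf α₀ hα₀
  obtain ⟨ε, hε, hbdd⟩ := FracSP.exists_ae_le_of_integral_posPart_le hs0 hs1 hC
  have hmain : ∀ n, ∀ M : ℝ, 0 < M → ∫ x, max (u n x - M) 0 ^ FracSP.critExp s ≤ ε →
      ∀ᵐ x, u n x ≤ 2 * M := fun n =>
    hbdd (u n) (huH n) (hpos n) fun h hh =>
      (hsol n).fracForm_posPart_le hs0 hs1 ht ht1 hα₀ (hVmeas n) (hV n) (hfC n) (hpos n) hh
  have hsmall : ∀ g : FracSP.R3 → ℝ, FracSP.MemHs s g → ∀ η : ℝ, 0 < η → ∃ M : ℝ, 0 < M ∧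
      ∫ x, max (g x - M) 0 ^ FracSP.critExp s ≤ η := by
    intro g hg η hη
    have h := FracSP.tendsto_integral_posPart_rpow (by linarith) hg.1.1
      (FracSP.integrable_rpow_critExp hs0 hs1 hg)
    obtain ⟨M, h1, h2⟩ := ((h.eventually_le_const hη).and (eventually_gt_atTop 0)).exists
    exact ⟨M, h2, h1⟩
  -- Chosen so that `2 ^ p * (η + η) = ε` when `posPart_rpow_le` is integrated.
  have hη : 0 < ε / (2 * 2 ^ FracSP.critExp s) := by positivity
  obtain ⟨M₀, hM₀, hwM⟩ := hsmall w hw _ hη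
  have hdiff : ∀ n, FracSP.MemHs s (fun x => u n x - w x) := fun n => (huH n).sub hw
  obtain ⟨N, hN⟩ := eventually_atTop.1
    ((FracSP.tendsto_integral_rpow_of_tendsto_HsNorm hs0 hs1 hdiff hconv).eventually_le_const hη)
  choose M hM hMle using fun n => hsmall (u n) (huH n) ε hε
  have hlarge : ∀ n, N ≤ n → ∫ x, max (u n x - M₀) 0 ^ FracSP.critExp s ≤ ε := by
    intro n hn
    have hi1 := FracSP.integrable_rpow_critExp hs0 hs1 (hdiff n)
    have hi2 := FracSP.integrable_posPart_rpow (by linarith) hw.1.1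
      (FracSP.integrable_rpow_critExp hs0 hs1 hw) hM₀.le
    calc ∫ x, max (u n x - M₀) 0 ^ FracSP.critExp s
        ≤ ∫ x, 2 ^ FracSP.critExp s * (|u n x - w x| ^ FracSP.critExp s +
            max (w x - M₀) 0 ^ FracSP.critExp s) :=
          integral_mono (FracSP.integrable_posPart_rpow (by linarith) (huH n).1.1
            (FracSP.integrable_rpow_critExp hs0 hs1 (huH n)) hM₀.le)
            ((hi1.add hi2).const_mul _) fun x => FracSP.posPart_rpow_le (by linarith) _ _ _
      _ = 2 ^ FracSP.critExp s * ((∫ x, |u n x - w x| ^ FracSP.critExp s) +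
            ∫ x, max (w x - M₀) 0 ^ FracSP.critExp s) := by
          rw [integral_const_mul, integral_add hi1 hi2]
      _ ≤ 2 ^ FracSP.critExp s * (ε / (2 * 2 ^ FracSP.critExp s) +
            ε / (2 * 2 ^ FracSP.critExp s)) :=
          mul_le_mul_of_nonneg_left (add_le_add (hN n hn) hwM) (by positivity)
      _ = ε := by field_simp; norm_num
  -- The sum stands in for a maximum: it dominates each `M n` with `n < N`, and being nonnegative it
  -- does not spoil the bound for `n ≥ N`.
  have hsum : 0 ≤ ∑ i ∈ Finset.range N, M i := Finset.sum_nonneg fun i _ => (hM i).le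
  refine ⟨2 * (M₀ + ∑ i ∈ Finset.range N, M i), by positivity, fun n => ?_⟩
  have hle : ∀ᵐ x, u n x ≤ 2 * (M₀ + ∑ i ∈ Finset.range N, M i) := by
    rcases le_or_gt N n with hn | hn
    · filter_upwards [hmain n M₀ hM₀ (hlarge n hn)] with x hx
      linarith
    · have h1 := Finset.single_le_sum (fun i _ => (hM i).le) (Finset.mem_range.2 hn)
      filter_upwards [hmain n (M n) (hM n) (hMle n)] with x hx
      linarith
  rw [eLpNorm_exponent_top]
  refine eLpNormEssSup_le_of_ae_bound ?_
  filter_upwards [hle, hpos n] with x h1 h2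
  rwa [Real.norm_of_nonneg h2]
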